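/- Use the convention that, for $a\ge 0$, $a^2/0=\infty$ if $a\neq 0$ and $a^2/0=0$ if $a=0$. Let \[ X_+=\left\{(x,y,t)\in\{0,1\}^2\times\mathbb{R}_+^2\times\mathbb{R}_+ :\ y_i(1-x_i)=0 \text{ for } i=1,2,\ \ t\ge (y_1+y_2)^2\right\}. \] Then the closure of the convex hull of $X_+$ is \[ \operatorname{cl}\operatorname{conv}(X_+)=\left\{(x,y,t)\in[0,1]^2\times\mathbb{R}^3_+ :\ t\ge f_{1+}(x,y)\right\}, \] where $f_{1+}:[0,1]^2\times\mathbb{R}_+^2\to[0,\infty]$ is the function \[ f_{1+}(x,y)=\begin{cases} \frac{y_1^2}{x_1}+\frac{y_2^2}{x_2} & \text{if } x_1+x_2\le 1,\\ \frac{y_2^2}{x_2}+\frac{y_1^2}{1-x_2} & \text{if } y_2>0 \text{ and } 0\le x_1+x_2-1\le (x_1y_2-x_2y_1)/y_2,\\ \frac{y_1^2}{x_1}+\frac{y_2^2}{1-x_1} & \text{if } y_1>0 \text{ and } 0\le x_1+x_2-1\le (x_2y_1-x_1y_2)/y_1,\\ (y_1+y_2)^2 & \text{otherwise,} \end{cases}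 \] the first applicable case being used. -/

import Mathlib

/-- The mixed-integer indicator set: `x ∈ {0,1}ⁿ`, `y ∈ ℝ₊ⁿ` and `y_i (1 - x_i) = 0` for all `i`. -/
def IndicatorSet (n : ℕ) : Set ((Fin n → ℝ) × (Fin n → ℝ)) :=
  {p | (∀ i, p.1 i = 0 ∨ p.1 i = 1) ∧ (∀ i, 0 ≤ p.2 i) ∧ ∀ i, p.2 i * (1 - p.1 i) = 0}

/-- The rank-one set `X₊`: points `(x, y, t)` with `(x, y)` in the bivariate indicator set,
`t ≥ 0` and `t ≥ (y₁ + y₂)²`. The coordinates `1, 2` are the indices `0, 1` of `Fin 2`. -/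
def XPlus : Set ((Fin 2 → ℝ) × (Fin 2 → ℝ) × ℝ) :=
  {p | (p.1, p.2.1) ∈ IndicatorSet 2 ∧ 0 ≤ p.2.2 ∧ (p.2.1 0 + p.2.1 1) ^ 2 ≤ p.2.2}

/-- The extended-real quotient `a² / b`, with the convention
`a² / 0 = ∞` if `a ≠ 0` and `0² / 0 = 0`. -/
noncomputable def sqDiv (a b : ℝ) : EReal :=
  if b = 0 then (if a = 0 then 0 else ⊤) else ((a ^ 2 / b : ℝ) : EReal)

/-- The four-piece function `f₁₊`, with values in the extended reals. The second and the third
case conditions divide by `y₂` and by `y₁`, so these cases require the divisor to be positive. -/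
noncomputable def fOnePlus (x y : Fin 2 → ℝ) : EReal :=
  if x 0 + x 1 ≤ 1 then
    sqDiv (y 0) (x 0) + sqDiv (y 1) (x 1)
  else if 0 < y 1 ∧ 0 ≤ x 0 + x 1 - 1 ∧ x 0 + x 1 - 1 ≤ (x 0 * y 1 - x 1 * y 0) / y 1 then
    sqDiv (y 1) (x 1) + sqDiv (y 0) (1 - x 1)
  else if 0 < y 0 ∧ 0 ≤ x 0 + x 1 - 1 ∧ x 0 + x 1 - 1 ≤ (x 1 * y 0 - x 0 * y 1) / y 0 then
    sqDiv (y 0) (x 0) + sqDiv (y 1) (1 - x 0)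
  else
    (((y 0 + y 1) ^ 2 : ℝ) : EReal)

/-! Points satisfying the bound are explicit combinations of one point over each vertex of the
square (`mem_convexHull_XPlus`), so the hull is already closed. Conversely, affine inequalities
valid on `XPlus` pass to the closure. Since `y²/x` is the supremum over `α` of `2αy - α²x`, attained
at `α = y/x`, each piece of `fOnePlus` is reached by one valid inequality; in the two middle pieces
validity needs an ordering of the slopes, which is exactly the case condition. -/

/-- A sum of two extended quotients is at most a real number exactly when both quotients are finite
and the real inequality holds. -/
theorem sqDiv_add_sqDiv_le_coe_iff (a b c d t : ℝ) :
    sqDiv a b + sqDiv c d ≤ (t : EReal) ↔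
      (b = 0 → a = 0) ∧ (d = 0 → c = 0) ∧ a ^ 2 / b + c ^ 2 / d ≤ t := by
  have key : ∀ a b : ℝ, (b = 0 → a = 0) → sqDiv a b = ((a ^ 2 / b : ℝ) : EReal) := by
    intro a b h
    unfold sqDiv
    split_ifs with h1 h2
    · simp [h1]
    · exact absurd (h h1) h2
    · rfl
  have top : ∀ a b : ℝ, ¬ (b = 0 → a = 0) → sqDiv a b = ⊤ := by
    intro a b h
    push Not at h
    simp [sqDiv, h.1, h.2]
  have bot : ∀ a b : ℝ, sqDiv a b ≠ ⊥ := by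
    intro a b
    by_cases h : b = 0 → a = 0
    · rw [key a b h]; exact EReal.coe_ne_bot _
    · rw [top a b h]; simp
  by_cases h1 : b = 0 → a = 0
  · by_cases h2 : d = 0 → c = 0
    · rw [key a b h1, key c d h2, ← EReal.coe_add, EReal.coe_le_coe_iff]
      exact ⟨fun h => ⟨h1, h2, h⟩, fun h => h.2.2⟩
    · rw [top c d h2, EReal.add_top_of_ne_bot (bot a b)]
      exact ⟨fun h => absurd (top_le_iff.1 h) (EReal.coe_ne_top t), fun h => absurd h.2.1 h2⟩
  · rw [top a b h1, EReal.top_add_of_ne_bot (bot c d)]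
    exact ⟨fun h => absurd (top_le_iff.1 h) (EReal.coe_ne_top t), fun h => absurd h.1 h1⟩

/-- The four possible shapes of a point of `XPlus`. -/
theorem XPlus_cases {p : (Fin 2 → ℝ) × (Fin 2 → ℝ) × ℝ} (hp : p ∈ XPlus) :
    0 ≤ p.2.1 0 ∧ 0 ≤ p.2.1 1 ∧ (p.2.1 0 + p.2.1 1) ^ 2 ≤ p.2.2 ∧
      (p.1 0 = 0 ∧ p.2.1 0 = 0 ∨ p.1 0 = 1) ∧ (p.1 1 = 0 ∧ p.2.1 1 = 0 ∨ p.1 1 = 1) := by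
  obtain ⟨⟨hx, hy, hxy⟩, -, ht⟩ := hp
  have h : ∀ i, p.1 i = 0 ∧ p.2.1 i = 0 ∨ p.1 i = 1 := by
    intro i
    rcases hx i with h | h
    · have := hxy i
      simp only [] at h this
      exact Or.inl ⟨h, by simpa [h] using this⟩
    · exact Or.inr h
  exact ⟨hy 0, hy 1, ht, h 0, h 1⟩

/-- An affine inequality valid on `XPlus` is valid on the closure of its convex hull. -/
theorem affine_le_of_mem_closure_convexHull_XPlus {p : (Fin 2 → ℝ) × (Fin 2 → ℝ) × ℝ}
    (hp : p ∈ closure (convexHull ℝ XPlus)) (A B C D E F : ℝ)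
    (h : ∀ q ∈ XPlus,
      A * q.1 0 + B * q.1 1 + C * q.2.1 0 + D * q.2.1 1 ≤ E * q.2.2 + F) :
    A * p.1 0 + B * p.1 1 + C * p.2.1 0 + D * p.2.1 1 ≤ E * p.2.2 + F := by
  refine closure_minimal (convexHull_min (t := {q : (Fin 2 → ℝ) × (Fin 2 → ℝ) × ℝ |
      A * q.1 0 + B * q.1 1 + C * q.2.1 0 + D * q.2.1 1 ≤ E * q.2.2 + F}) h ?_) ?_ hp
  · intro u hu v hv a b ha hb hab
    simp only [Set.mem_ofPred_eq, Prod.fst_add, Prod.snd_add, Prod.smul_fst, Prod.smul_snd,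
      Pi.add_apply, Pi.smul_apply, smul_eq_mul] at hu hv ⊢
    have hF : F = a * F + b * F := by rw [← add_mul, hab, one_mul]
    rw [hF]
    linarith [mul_le_mul_of_nonneg_left hu ha, mul_le_mul_of_nonneg_left hv hb]
  · exact isClosed_le (by fun_prop) (by fun_prop)

/-- A weighted combination of one point over each of the four vertices of the unit square. -/
theorem mem_convexHull_XPlus {x y : Fin 2 → ℝ} {t : ℝ} (w₀ w₁ w₂ w₃ a b c d : ℝ)
    (hw₀ : 0 ≤ w₀) (hw₁ : 0 ≤ w₁) (hw₂ : 0 ≤ w₂) (hw₃ : 0 ≤ w₃) (hw : w₀ + w₁ + w₂ + w₃ = 1)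
    (ha : 0 ≤ a) (hb : 0 ≤ b) (hc : 0 ≤ c) (hd : 0 ≤ d)
    (hx0 : x 0 = w₁ + w₃) (hx1 : x 1 = w₂ + w₃)
    (hy0 : y 0 = w₁ * a + w₃ * c) (hy1 : y 1 = w₂ * b + w₃ * d)
    (ht : w₁ * a ^ 2 + w₂ * b ^ 2 + w₃ * (c + d) ^ 2 ≤ t) :
    (x, y, t) ∈ convexHull ℝ XPlus := by
  -- The slack in `t` is added to all four points; the weights sum to one.
  obtain ⟨e, he⟩ : ∃ e, t = w₁ * a ^ 2 + w₂ * b ^ 2 + w₃ * (c + d) ^ 2 + e := 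
    ⟨t - (w₁ * a ^ 2 + w₂ * b ^ 2 + w₃ * (c + d) ^ 2), by ring⟩
  have he0 : 0 ≤ e := by linarith
  let P : Fin 4 → (Fin 2 → ℝ) × (Fin 2 → ℝ) × ℝ :=
    ![(![0, 0], ![0, 0], e), (![1, 0], ![a, 0], a ^ 2 + e), (![0, 1], ![0, b], b ^ 2 + e),
      (![1, 1], ![c, d], (c + d) ^ 2 + e)]
  have hP : ∀ i ∈ Finset.univ, P i ∈ convexHull ℝ XPlus := by
    intro i _
    apply subset_convexHull
    fin_cases i <;>
      simp [P, XPlus, IndicatorSet, Fin.forall_fin_two, ha, hb, hc, hd, he0] <;> positivity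
  have := (convex_convexHull ℝ XPlus).sum_mem (w := ![w₀, w₁, w₂, w₃]) (t := Finset.univ)
    (by intro i _; fin_cases i <;> simpa) (by simp [Fin.sum_univ_four, hw]) hP
  convert this using 1
  refine Prod.ext ?_ (Prod.ext ?_ ?_)
  · ext i; fin_cases i <;> simp [P, Fin.sum_univ_four, hx0, hx1]
  · ext i; fin_cases i <;> simp [P, Fin.sum_univ_four, hy0, hy1]
  · simp only [P, Fin.sum_univ_four, he]
    simp
    linear_combination (-e) * hw

theorem mul_sq_div_self (x y : ℝ) : x * (y / x) ^ 2 = y ^ 2 / x := by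
  by_cases hx : x = 0
  · simp [hx]
  · field_simp

/-- The quotient `y² / x` as the value of its tangent. -/
theorem two_mul_div_sub_sq_mul (x y : ℝ) :
    2 * (y / x) * y - (y / x) ^ 2 * x = y ^ 2 / x := by
  by_cases hx : x = 0
  · simp [hx]
  · field_simp; ring

/-- The case condition of `fOnePlus` without division by `y`. -/
theorem sub_one_le_div_iff {x x' y y' : ℝ} (hy : 0 < y') :
    x + x' - 1 ≤ (x * y' - x' * y) / y' ↔ y * x' ≤ (1 - x') * y' := by
  rw [le_div_iff₀ hy]
  constructor <;> intro h <;> linarith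

theorem mem_convexHull_XPlus_of_fOnePlus_le {x y : Fin 2 → ℝ} {t : ℝ}
    (hx : ∀ i, x i ∈ Set.Icc (0 : ℝ) 1) (hy : ∀ i, 0 ≤ y i)
    (hf : fOnePlus x y ≤ (t : EReal)) : (x, y, t) ∈ convexHull ℝ XPlus := by
  obtain ⟨x0, x0'⟩ := hx 0
  obtain ⟨x1, x1'⟩ := hx 1
  have y0 := hy 0
  have y1 := hy 1
  unfold fOnePlus at hf
  split_ifs at hf with h1 h2 h3
  · rw [sqDiv_add_sqDiv_le_coe_iff] at hf
    obtain ⟨e0, e1, hf⟩ := hf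
    -- No mass at `(1,1)`, so the cross term never appears.
    refine mem_convexHull_XPlus (1 - x 0 - x 1) (x 0) (x 1) 0 (y 0 / x 0) (y 1 / x 1) 0 0
      (by linarith) x0 x1 le_rfl (by ring) (by positivity) (by positivity) le_rfl le_rfl
      (by ring) (by ring) ?_ ?_ ?_
    · rw [mul_div_cancel_of_imp' e0]; ring
    · rw [mul_div_cancel_of_imp' e1]; ring
    · rw [mul_sq_div_self, mul_sq_div_self]; linarith
  · rw [sqDiv_add_sqDiv_le_coe_iff] at hf
    obtain ⟨e1, e0, hf⟩ := hf
    have hs : 0 ≤ 1 - x 1 := by linarith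
    -- No mass at `(0,0)`; `y 0` sits on `(1,0)` alone, while `y 1` is spread evenly over both
    -- vertices with second coordinate `1`.
    refine mem_convexHull_XPlus 0 (1 - x 1) (1 - x 0) (x 0 + x 1 - 1)
      (y 0 / (1 - x 1)) (y 1 / x 1) 0 (y 1 / x 1)
      le_rfl hs (by linarith) (by linarith) (by ring) (by positivity) (by positivity) le_rfl
      (by positivity) (by ring) (by ring) ?_ ?_ ?_
    · rw [mul_div_cancel_of_imp' e0]; ring
    · linear_combination -mul_div_cancel_of_imp' e1
    · rw [mul_sq_div_self]; linarith [mul_sq_div_self (x 1) (y 1)]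
  · rw [sqDiv_add_sqDiv_le_coe_iff] at hf
    obtain ⟨e0, e1, hf⟩ := hf
    have hs : 0 ≤ 1 - x 0 := by linarith
    refine mem_convexHull_XPlus 0 (1 - x 1) (1 - x 0) (x 0 + x 1 - 1)
      (y 0 / x 0) (y 1 / (1 - x 0)) (y 0 / x 0) 0
      le_rfl (by linarith) hs (by linarith) (by ring) (by positivity) (by positivity)
      (by positivity) le_rfl (by ring) (by ring) ?_ ?_ ?_
    · linear_combination -mul_div_cancel_of_imp' e0
    · rw [mul_div_cancel_of_imp' e1]; ring
    · rw [mul_sq_div_self]; linarith [mul_sq_div_self (x 0) (y 0)]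
  · rw [EReal.coe_le_coe_iff] at hf
    have hw : 0 < x 0 + x 1 - 1 := by linarith
    -- Failure of the middle cases makes the values used at `(1,1)` nonnegative.
    have c0 : (1 - x 1) * (y 0 + y 1) ≤ y 0 := by
      rcases y1.eq_or_lt with h | h
      · rw [← h]; nlinarith
      · have : ¬ _ := fun h' => h2 ⟨h, hw.le, (sub_one_le_div_iff h).2 h'⟩
        linarith
    have c1 : (1 - x 0) * (y 0 + y 1) ≤ y 1 := by
      rcases y0.eq_or_lt with h | h
      · rw [← h]; nlinarith
      · have : ¬ _ := fun h' => h3 ⟨h, hw.le, by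
          rw [add_comm (x 0)]; exact (sub_one_le_div_iff h).2 h'⟩
        linarith
    have hcd : (y 0 - (1 - x 1) * (y 0 + y 1)) / (x 0 + x 1 - 1) +
        (y 1 - (1 - x 0) * (y 0 + y 1)) / (x 0 + x 1 - 1) = y 0 + y 1 := by
      field_simp; ring
    -- All three vertices carry the same total `y 0 + y 1`, so Jensen is tight; the split at `(1,1)`
    -- is then forced.
    refine mem_convexHull_XPlus 0 (1 - x 1) (1 - x 0) (x 0 + x 1 - 1) (y 0 + y 1) (y 0 + y 1)
      ((y 0 - (1 - x 1) * (y 0 + y 1)) / (x 0 + x 1 - 1))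
      ((y 1 - (1 - x 0) * (y 0 + y 1)) / (x 0 + x 1 - 1))
      le_rfl (by linarith) (by linarith) hw.le (by ring) (by positivity) (by positivity)
      (div_nonneg (by linarith) hw.le) (div_nonneg (by linarith) hw.le) (by ring) (by ring)
      ?_ ?_ ?_
    · rw [mul_div_cancel₀ _ hw.ne']; ring
    · rw [mul_div_cancel₀ _ hw.ne']; ring
    · rw [hcd]; linarith

/-- The inequality that bounds the perspective of each variable separately. -/
theorem separable_tangent_le {p : (Fin 2 → ℝ) × (Fin 2 → ℝ) × ℝ}
    (hp : p ∈ closure (convexHull ℝ XPlus)) (α β : ℝ) :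
    2 * α * p.2.1 0 - α ^ 2 * p.1 0 + (2 * β * p.2.1 1 - β ^ 2 * p.1 1) ≤ p.2.2 := by
  have := affine_le_of_mem_closure_convexHull_XPlus hp (-α ^ 2) (-β ^ 2) (2 * α) (2 * β) 1 0 ?_
  · linarith
  intro q hq
  obtain ⟨h0, h1, ht, ⟨a, b⟩ | a, ⟨c, d⟩ | c⟩ := XPlus_cases hq <;> simp only [*] at * <;>
    nlinarith [sq_nonneg (q.2.1 0 - α), sq_nonneg (q.2.1 1 - β), mul_nonneg h0 h1]

/-- The critical vertex is `(1,1)`: there `α ≤ β` and `y₁ ≥ 0` bound the left side by the tangent of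
the square at `β`, evaluated at `y₁ + y₂`. -/
theorem tangent_le_of_le_right {p : (Fin 2 → ℝ) × (Fin 2 → ℝ) × ℝ}
    (hp : p ∈ closure (convexHull ℝ XPlus)) {α β : ℝ} (h : α ≤ β) :
    2 * β * p.2.1 1 - β ^ 2 * p.1 1 + (2 * α * p.2.1 0 - α ^ 2 * (1 - p.1 1)) ≤ p.2.2 := by
  have := affine_le_of_mem_closure_convexHull_XPlus hp 0 (α ^ 2 - β ^ 2) (2 * α) (2 * β) 1
    (α ^ 2) ?_
  · linarith
  intro q hq
  obtain ⟨h0, h1, ht, ⟨a, b⟩ | a, ⟨c, d⟩ | c⟩ := XPlus_cases hq <;> simp only [*] at * <;>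
    nlinarith [sq_nonneg (q.2.1 0 - α), sq_nonneg (q.2.1 0 + q.2.1 1 - β), sq_nonneg (q.2.1 1 - β),
      mul_nonneg h0 (sub_nonneg.2 h), sq_nonneg α]

theorem tangent_le_of_le_left {p : (Fin 2 → ℝ) × (Fin 2 → ℝ) × ℝ}
    (hp : p ∈ closure (convexHull ℝ XPlus)) {α β : ℝ} (h : β ≤ α) :
    2 * α * p.2.1 0 - α ^ 2 * p.1 0 + (2 * β * p.2.1 1 - β ^ 2 * (1 - p.1 0)) ≤ p.2.2 := by
  have := affine_le_of_mem_closure_convexHull_XPlus hp (β ^ 2 - α ^ 2) 0 (2 * α) (2 * β) 1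
    (β ^ 2) ?_
  · linarith
  intro q hq
  obtain ⟨h0, h1, ht, ⟨a, b⟩ | a, ⟨c, d⟩ | c⟩ := XPlus_cases hq <;> simp only [*] at * <;>
    nlinarith [sq_nonneg (q.2.1 1 - β), sq_nonneg (q.2.1 0 + q.2.1 1 - α), sq_nonneg (q.2.1 0 - α),
      mul_nonneg h1 (sub_nonneg.2 h), sq_nonneg β]

theorem sq_add_le_of_mem_closure {p : (Fin 2 → ℝ) × (Fin 2 → ℝ) × ℝ}
    (hp : p ∈ closure (convexHull ℝ XPlus)) : (p.2.1 0 + p.2.1 1) ^ 2 ≤ p.2.2 := by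
  have := affine_le_of_mem_closure_convexHull_XPlus hp 0 0 (2 * (p.2.1 0 + p.2.1 1))
    (2 * (p.2.1 0 + p.2.1 1)) 1 ((p.2.1 0 + p.2.1 1) ^ 2) ?_
  · linarith
  intro q hq
  obtain ⟨-, -, ht, -⟩ := XPlus_cases hq
  linarith [sq_nonneg (q.2.1 0 + q.2.1 1 - (p.2.1 0 + p.2.1 1))]

/-- A variable with bounded perspective vanishes where its indicator does. -/
theorem eq_zero_of_forall_two_mul_le {y t : ℝ} (h : ∀ α : ℝ, 2 * α * y ≤ t) : y = 0 := by
  by_contra hy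
  have := h ((t + 1) / (2 * y))
  rw [show 2 * ((t + 1) / (2 * y)) * y = t + 1 by field_simp] at this
  linarith

theorem mem_Icc_and_nonneg_of_mem_closure {p : (Fin 2 → ℝ) × (Fin 2 → ℝ) × ℝ}
    (hp : p ∈ closure (convexHull ℝ XPlus)) :
    (∀ i, p.1 i ∈ Set.Icc (0 : ℝ) 1) ∧ ∀ i, 0 ≤ p.2.1 i := by
  have key : ∀ A B C D F : ℝ, (∀ q ∈ XPlus,
      A * q.1 0 + B * q.1 1 + C * q.2.1 0 + D * q.2.1 1 ≤ 0 * q.2.2 + F) →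
      A * p.1 0 + B * p.1 1 + C * p.2.1 0 + D * p.2.1 1 ≤ 0 * p.2.2 + F :=
    fun A B C D F => affine_le_of_mem_closure_convexHull_XPlus hp A B C D 0 F
  have bounds : ∀ q ∈ XPlus, 0 ≤ q.1 0 ∧ q.1 0 ≤ 1 ∧ 0 ≤ q.1 1 ∧ q.1 1 ≤ 1 := by
    intro q hq
    obtain ⟨-, -, -, ⟨a, -⟩ | a, ⟨c, -⟩ | c⟩ := XPlus_cases hq <;> simp [a, c]
  have l0 := key (-1) 0 0 0 0 fun q hq => by linarith [(bounds q hq).1]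
  have u0 := key 1 0 0 0 1 fun q hq => by linarith [(bounds q hq).2.1]
  have l1 := key 0 (-1) 0 0 0 fun q hq => by linarith [(bounds q hq).2.2.1]
  have u1 := key 0 1 0 0 1 fun q hq => by linarith [(bounds q hq).2.2.2]
  have n0 := key 0 0 (-1) 0 0 fun q hq => by linarith [(XPlus_cases hq).1]
  have n1 := key 0 0 0 (-1) 0 fun q hq => by linarith [(XPlus_cases hq).2.1]
  simp only [Fin.forall_fin_two, Set.mem_Icc]
  refine ⟨⟨⟨?_, ?_⟩, ?_, ?_⟩, ?_, ?_⟩ <;> linarith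

theorem fOnePlus_le_of_mem_closure {p : (Fin 2 → ℝ) × (Fin 2 → ℝ) × ℝ}
    (hp : p ∈ closure (convexHull ℝ XPlus)) : fOnePlus p.1 p.2.1 ≤ (p.2.2 : EReal) := by
  obtain ⟨hx, hy⟩ := mem_Icc_and_nonneg_of_mem_closure hp
  obtain ⟨x0, x0'⟩ := hx 0
  obtain ⟨x1, x1'⟩ := hx 1
  have e0 : p.1 0 = 0 → p.2.1 0 = 0 := fun h => eq_zero_of_forall_two_mul_le fun α => by
    have := separable_tangent_le hp α 0
    rw [h] at this; linarith
  have e1 : p.1 1 = 0 → p.2.1 1 = 0 := fun h => eq_zero_of_forall_two_mul_le fun β => by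
    have := separable_tangent_le hp 0 β
    rw [h] at this; linarith
  unfold fOnePlus
  split_ifs with h1 h2 h3
  · rw [sqDiv_add_sqDiv_le_coe_iff]
    refine ⟨e0, e1, ?_⟩
    rw [← two_mul_div_sub_sq_mul (p.1 0) (p.2.1 0), ← two_mul_div_sub_sq_mul (p.1 1) (p.2.1 1)]
    exact separable_tangent_le hp _ _
  · obtain ⟨hy1, -, hc⟩ := h2
    rw [sub_one_le_div_iff hy1] at hc
    have hx1 : 0 < p.1 1 := by linarith
    have e : 1 - p.1 1 = 0 → p.2.1 0 = 0 := fun h => by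
      rw [h, show p.1 1 = 1 by linarith] at hc
      linarith [hy 0]
    rw [sqDiv_add_sqDiv_le_coe_iff]
    refine ⟨e1, e, ?_⟩
    rw [← two_mul_div_sub_sq_mul (p.1 1) (p.2.1 1), ← two_mul_div_sub_sq_mul (1 - p.1 1)]
    apply tangent_le_of_le_right hp
    -- If `x₂ = 1`, division by zero makes the smaller slope `0`; otherwise the ordering is `hc`
    -- cross-multiplied.
    rcases (sub_nonneg.2 x1').eq_or_lt with h | h
    · rw [← h, div_zero]; positivity
    · rw [div_le_div_iff₀ h hx1]; linarith
  · obtain ⟨hy0, -, hc⟩ := h3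
    rw [add_comm (p.1 0), sub_one_le_div_iff hy0] at hc
    have hx0 : 0 < p.1 0 := by linarith
    have e : 1 - p.1 0 = 0 → p.2.1 1 = 0 := fun h => by
      rw [h, show p.1 0 = 1 by linarith] at hc
      linarith [hy 1]
    rw [sqDiv_add_sqDiv_le_coe_iff]
    refine ⟨e0, e, ?_⟩
    rw [← two_mul_div_sub_sq_mul (p.1 0) (p.2.1 0), ← two_mul_div_sub_sq_mul (1 - p.1 0)]
    apply tangent_le_of_le_left hp
    rcases (sub_nonneg.2 x0').eq_or_lt with h | h
    · rw [← h, div_zero]; positivity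
    · rw [div_le_div_iff₀ h hx0]; linarith
  · exact EReal.coe_le_coe_iff.2 (sq_add_le_of_mem_closure hp)

theorem mainTheorem10 :
    closure (convexHull ℝ XPlus) =
      {p : (Fin 2 → ℝ) × (Fin 2 → ℝ) × ℝ |
        (∀ i, p.1 i ∈ Set.Icc (0 : ℝ) 1) ∧ (∀ i, 0 ≤ p.2.1 i) ∧ 0 ≤ p.2.2 ∧
          fOnePlus p.1 p.2.1 ≤ (p.2.2 : EReal)} := by
  ext p
  constructor
  · intro hp
    obtain ⟨hx, hy⟩ := mem_Icc_and_nonneg_of_mem_closure hp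
    exact ⟨hx, hy, (sq_nonneg _).trans (sq_add_le_of_mem_closure hp),
      fOnePlus_le_of_mem_closure hp⟩
  · rintro ⟨hx, hy, -, hf⟩
    exact subset_closure (mem_convexHull_XPlus_of_fOnePlus_le hx hy hf)
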